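/- Cut the oriented sphere along a circle into two discs, and mark four points on the circle. For positive integers $p,q$ let the *double twist diagram* $D(p,q)$ be the following link diagram on the sphere. The first disc contains two strands which run alongside an edge $e$ joining two opposite of the four boundary arcs and which cross each other $p$ times (a row of $p$ half twists along $e$). The second disc contains two strands which run alongside an edge $e'$ joining the other two boundary arcs and which cross each other $q$ times (a row of $q$ half twists along $e'$). The strands are joined at the four marked points. All crossings are positive with respect to their edge: if the edge, with the orientation of the sphere, is followed in either direction, the under-strand passes from the left of the edge to the right, and the over-strand from the right to the left. (Thus the two rows are twisted in the same way relative to their own edges, and $D(p,q)$ is non-alternating.) If $p$ and $q$ are even, $D(p,q)$ is a knot diagram; let $K(p,q)$ denote the knot that it represents. Two knot diagrams on the oriented sphere represent the same (unoriented) knot if they are related by a finite sequence of Reidemeister moves and orientation-preserving homeomorphisms of the sphere, that is, if the knots in $S^3$ that they represent are ambient isotopic. **Theorem.** Let $p,q,a,b$ be even positive integers. Then $K(p,q)=K(a,b)$ if and only if $\{p,q\}=\{a,b\}$. -/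

import Mathlib

namespace KnotDiag

/-!
# Knots as planar diagrams up to Reidemeister moves

A diagram on the oriented sphere is written as a planar diagram code. The arcs carry names
(natural numbers), and the code is the multiset of the vertices of the diagram, each vertex listing
the arcs that leave it in counterclockwise order. Besides crossings there are marked points
subdividing arcs, so that gluing pieces of diagrams, and the circle without crossings, need no
separate treatment.
-/

/-- A vertex of a diagram.
* `cross a b c d`: a crossing which the arcs `a`, `b`, `c`, `d` leave in counterclockwise order;
  the strand through `a` and `c` passes under the strand through `b` and `d`.
* `pt a b`: a marked point, at which the arc `a` continues as the arc `b`. -/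
inductive Node : Type
  | cross (a b c d : ℕ) : Node
  | pt (a b : ℕ) : Node

/-- The ends of arcs at a vertex. -/
def Node.arcs : Node → Multiset ℕ
  | .cross a b c d => {a, b, c, d}
  | .pt a b => {a, b}

/-- Renaming of the arcs. -/
def Node.relabel (f : ℕ → ℕ) : Node → Node
  | .cross a b c d => .cross (f a) (f b) (f c) (f d)
  | .pt a b => .pt (f a) (f b)

/-- The number of crossings (1 or 0) at a vertex. -/
def Node.crossings : Node → ℕ
  | .cross _ _ _ _ => 1
  | .pt _ _ => 0

/-- A planar diagram code. -/
abbrev Code : Type := Multiset Node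

/-- The ends of arcs at all vertices of the code. -/
def Code.arcs (D : Code) : Multiset ℕ := D.bind Node.arcs

/-- The number of crossings of the code. -/
def Code.crossings (D : Code) : ℕ := (D.map Node.crossings).sum

/-- Every arc has exactly two ends. -/
def Code.ArcsTwice (D : Code) : Prop := ∀ a ∈ D.arcs, D.arcs.count a = 2

/-- The arc `x` is continued, at some vertex, by the arc `y`. -/
def Code.Strand (D : Code) (x y : ℕ) : Prop :=
  (∃ b d, Node.cross x b y d ∈ D) ∨ (∃ a c, Node.cross a x c y ∈ D) ∨ Node.pt x y ∈ D

/-- The diagram has one component: following the strands one gets from any arc to any other. -/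
def Code.OneComponent (D : Code) : Prop :=
  ∀ x ∈ D.arcs, ∀ y ∈ D.arcs, Relation.EqvGen D.Strand x y

/-- A vertex together with names of the regions that meet it: at `cross a b c d ab bc cd da` the
region `ab` lies between the consecutive arcs `a` and `b`, and so on; at `pt a b l r` the region `l`
is on the left and `r` on the right when one passes from `a` to `b`. -/
inductive RegionNode : Type
  | cross (a b c d ab bc cd da : ℕ) : RegionNode
  | pt (a b l r : ℕ) : RegionNode

/-- Forget the regions. -/
def RegionNode.toNode : RegionNode → Node
  | .cross a b c d _ _ _ _ => .cross a b c d
  | .pt a b _ _ => .pt a b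

/-- The ends of arcs at a vertex, each with the regions on the left and on the right of the arc as
seen when one leaves the vertex along it. -/
def RegionNode.ends : RegionNode → Multiset (ℕ × ℕ × ℕ)
  | .cross a b c d ab bc cd da => {(a, ab, da), (b, bc, ab), (c, cd, bc), (d, da, cd)}
  | .pt a b l r => {(a, r, l), (b, l, r)}

/-- The same arc with the same two regions next to it, seen from its other end. -/
def flipEnd (t : ℕ × ℕ × ℕ) : ℕ × ℕ × ℕ := (t.1, t.2.2, t.2.1)

/-- The code of a connected diagram is planar: the regions around the vertices can be named so that
the two ends of each arc see the same two regions, on opposite sides (`T` lists every arc once, seen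
from one of its ends), and there are `crossings + 2` different regions. By Euler's formula a
connected diagram with `n` crossings on a closed oriented surface of genus `g`, whose complement
consists of discs, has `n + 2 - 2 * g` regions, so this says that the surface is the sphere. -/
def Code.Planar (D : Code) : Prop :=
  ∃ (E : Multiset RegionNode) (T : Multiset (ℕ × ℕ × ℕ)),
    E.map RegionNode.toNode = D ∧
    E.bind RegionNode.ends = T + T.map flipEnd ∧
    (T.map (fun t => t.2.1) + T.map (fun t => t.2.2)).toFinset.card = D.crossings + 2

/-- A knot diagram on the oriented sphere. -/
structure KnotDiagram : Type where
  code : Code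
  arcsTwice : code.ArcsTwice
  oneComponent : code.OneComponent
  planar : code.Planar

/-- Two notations for the same vertex. -/
inductive Node.Same : Node → Node → Prop
  | refl (v : Node) : Node.Same v v
  | rotate (a b c d : ℕ) : Node.Same (.cross a b c d) (.cross c d a b)
  | swap (a b : ℕ) : Node.Same (.pt a b) (.pt b a)

/-- Elementary moves between codes: change of notation, removal of a marked point, and the
Reidemeister moves. They are used in both directions, and between codes of knot diagrams only. -/
inductive Move : Code → Code → Prop
  /-- The same diagram, with other names for the arcs and possibly another notation for each
  vertex. -/
  | rename (σ : Equiv.Perm ℕ) {D D' : Code}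
      (h : Multiset.Rel Node.Same (D.map (Node.relabel σ)) D') : Move D D'
  /-- The marked point between the different arcs `a` and `b` is removed, and the united arc is
  called `a`. -/
  | unmark {a b : ℕ} (h : a ≠ b) (R : Code) :
      Move (Node.pt a b ::ₘ R) (R.map (Node.relabel fun x => if x = b then a else x))
  /-- First Reidemeister move: removal of a curl (of one sign). -/
  | reidemeister1 (a b c : ℕ) (R : Code) :
      Move (Node.cross a b b c ::ₘ R) (Node.pt a c ::ₘ R)
  /-- First Reidemeister move: removal of a curl (of the other sign). -/
  | reidemeister1' (a b c : ℕ) (R : Code) :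
      Move (Node.cross b b a c ::ₘ R) (Node.pt a c ::ₘ R)
  /-- Second Reidemeister move: the strand `b f d` passes over the strand `a e c` twice, and `e`,
  `f` bound a bigon. -/
  | reidemeister2 (a b c d e f : ℕ) (R : Code) :
      Move ({Node.cross a f e b, Node.cross e f c d} + R) ({Node.pt a c, Node.pt b d} + R)
  /-- Third Reidemeister move. The ends `e₁, …, e₆` lie in counterclockwise order around a disc; the
  strand `e₁ x e₄` is at the bottom, `e₂ y e₅` in the middle and `e₃ z e₆` on top. -/
  | reidemeister3 (e₁ e₂ e₃ e₄ e₅ e₆ x y z : ℕ) (R : Code) :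
      Move ({Node.cross e₁ e₂ x y, Node.cross e₄ z x e₃, Node.cross e₅ e₆ y z} + R)
        ({Node.cross e₄ e₅ x y, Node.cross e₁ z x e₆, Node.cross e₂ e₃ y z} + R)
  /-- Third Reidemeister move, with `e₁ x e₄` at the bottom, `e₃ z e₆` in the middle and `e₂ y e₅`
  on top. -/
  | reidemeister3' (e₁ e₂ e₃ e₄ e₅ e₆ x y z : ℕ) (R : Code) :
      Move ({Node.cross e₁ e₂ x y, Node.cross e₄ z x e₃, Node.cross e₆ y z e₅} + R)
        ({Node.cross e₄ e₅ x y, Node.cross e₁ z x e₆, Node.cross e₃ y z e₂} + R)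

/-- A (classical, unoriented) knot: a knot diagram on the sphere up to the equivalence relation
generated by the moves. All intermediate diagrams are planar knot diagrams. -/
def Knot : Type := Quot fun D D' : KnotDiagram => Move D.code D'.code

/-- `n` positive half twists along an edge. Two strands run along the edge; between the crossings
number `i - 1` and `i` the left one is the arc `l i` and the right one is the arc `r i`. -/
def twists (l r : ℕ → ℕ) (n : ℕ) : Code :=
  (Multiset.range n).map fun i => Node.cross (l i) (r i) (r (i + 1)) (l (i + 1))

/-- The double twist diagram. The sphere is the union of two discs, with `p` positive half twists
along the edge of the tree in the first disc and `q` along the edge of the tree in the second. The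
four points on the common boundary circle are, in cyclic order, the beginnings of the first edge's
left strand and right strand and the ends of its right strand and left strand (north-west,
south-west, south-east, north-east if the first edge runs from west to east); the second edge
starts between the two left points (north) and ends between the two right points (south). -/
def doubleTwistCode (p q : ℕ) : Code :=
  twists (fun i => 4 * i) (fun i => 4 * i + 1) p +
  twists (fun j => 4 * j + 2) (fun j => 4 * j + 3) q +
  {Node.pt (4 * 0) (4 * 0 + 2), Node.pt (4 * p) (4 * 0 + 3),
   Node.pt (4 * 0 + 1) (4 * q + 2), Node.pt (4 * p + 1) (4 * q + 3)}

theorem range_telescope {α : Type} (x y x' y' : ℕ → α) (n : ℕ) :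
    ((Multiset.range n).bind fun i => ({x i, y i, y' (i + 1), x' (i + 1)} : Multiset α)) +
        {x' 0, y' 0, x n, y n} =
      (Multiset.range (n + 1)).bind fun i => ({x i, x' i, y i, y' i} : Multiset α) := by
  induction n with
  | zero =>
    simp only [Multiset.range_succ, Multiset.range_zero, Multiset.insert_eq_cons,
      ← Multiset.singleton_add, Multiset.add_bind, Multiset.singleton_bind, Multiset.zero_bind]
    abel
  | succ n ih =>
    rw [Multiset.range_succ (n := n + 1), Multiset.cons_bind, ← ih, Multiset.range_succ,
      Multiset.cons_bind]
    simp only [Multiset.insert_eq_cons, ← Multiset.singleton_add]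
    abel

/-- The vertices of a twist region with names of the regions: `m i` between the crossings number
`i - 1` and `i`, `L` on the left and `R` on the right of the edge. -/
def twistsR (l r m : ℕ → ℕ) (L R n : ℕ) : Multiset RegionNode :=
  (Multiset.range n).map fun i =>
    RegionNode.cross (l i) (r i) (r (i + 1)) (l (i + 1)) (m i) R (m (i + 1)) L

theorem twistsR_toNode (l r m : ℕ → ℕ) (L R n : ℕ) :
    (twistsR l r m L R n).map RegionNode.toNode = twists l r n := by
  rw [twistsR, twists, Multiset.map_map]
  rfl

/-- The arcs of a twist region. -/
def twistsT (l r m : ℕ → ℕ) (L R n : ℕ) : Multiset (ℕ × ℕ × ℕ) :=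
  (Multiset.range (n + 1)).map (fun i => (l i, L, m i)) +
  (Multiset.range (n + 1)).map (fun i => (r i, m i, R))

theorem twistsR_ends (l r m : ℕ → ℕ) (L R n : ℕ) :
    (twistsR l r m L R n).bind RegionNode.ends +
        {(l 0, L, m 0), (r 0, m 0, R), (l n, m n, L), (r n, R, m n)} =
      twistsT l r m L R n + (twistsT l r m L R n).map flipEnd := by
  have h := range_telescope (fun i => (l i, m i, L)) (fun i => (r i, R, m i))
    (fun i => (l i, L, m i)) (fun i => (r i, m i, R)) n
  have e : (twistsR l r m L R n).bind RegionNode.ends =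
      (Multiset.range n).bind fun i =>
        ({(l i, m i, L), (r i, R, m i), (r (i + 1), m (i + 1), R), (l (i + 1), L, m (i + 1))} :
          Multiset (ℕ × ℕ × ℕ)) := by
    simp [twistsR, Multiset.bind_map, RegionNode.ends]
  rw [e, h]
  simp only [twistsT, Multiset.map_add, Multiset.map_map, flipEnd, Function.comp_def]
  simp only [Multiset.insert_eq_cons, ← Multiset.singleton_add, Multiset.bind_add,
    Multiset.bind_singleton]
  abel

/-- The arcs of the double twist diagram, with the regions next to them. -/
def doubleTwistT (p q : ℕ) : Multiset (ℕ × ℕ × ℕ) :=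
  twistsT (fun i => 4 * i) (fun i => 4 * i + 1) (fun i => 2 * i) 1 (2 * q + 1) p +
  twistsT (fun j => 4 * j + 2) (fun j => 4 * j + 3) (fun j => 2 * j + 1) 0 (2 * p) q

/-- The double twist diagram with names of the regions. -/
def doubleTwistR (p q : ℕ) : Multiset RegionNode :=
  twistsR (fun i => 4 * i) (fun i => 4 * i + 1) (fun i => 2 * i) 1 (2 * q + 1) p +
  twistsR (fun j => 4 * j + 2) (fun j => 4 * j + 3) (fun j => 2 * j + 1) 0 (2 * p) q +
  {RegionNode.pt (4 * 0) (4 * 0 + 2) 0 1, RegionNode.pt (4 * p) (4 * 0 + 3) 1 (2 * p),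
   RegionNode.pt (4 * 0 + 1) (4 * q + 2) (2 * q + 1) 0,
   RegionNode.pt (4 * p + 1) (4 * q + 3) (2 * p) (2 * q + 1)}

theorem doubleTwistR_toNode (p q : ℕ) :
    (doubleTwistR p q).map RegionNode.toNode = doubleTwistCode p q := by
  simp [doubleTwistR, doubleTwistCode, twistsR_toNode, RegionNode.toNode]

theorem doubleTwistR_ends (p q : ℕ) :
    (doubleTwistR p q).bind RegionNode.ends =
      doubleTwistT p q + (doubleTwistT p q).map flipEnd := by
  have h₁ := twistsR_ends (fun i => 4 * i) (fun i => 4 * i + 1) (fun i => 2 * i) 1 (2 * q + 1) p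
  have h₂ := twistsR_ends (fun j => 4 * j + 2) (fun j => 4 * j + 3) (fun j => 2 * j + 1) 0 (2 * p) q
  have e : doubleTwistT p q + (doubleTwistT p q).map flipEnd =
      (twistsT (fun i => 4 * i) (fun i => 4 * i + 1) (fun i => 2 * i) 1 (2 * q + 1) p +
        (twistsT (fun i => 4 * i) (fun i => 4 * i + 1) (fun i => 2 * i) 1 (2 * q + 1) p).map
          flipEnd) +
      (twistsT (fun j => 4 * j + 2) (fun j => 4 * j + 3) (fun j => 2 * j + 1) 0 (2 * p) q +
        (twistsT (fun j => 4 * j + 2) (fun j => 4 * j + 3) (fun j => 2 * j + 1) 0 (2 * p) q).map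
          flipEnd) := by
    simp only [doubleTwistT, Multiset.map_add]
    abel
  rw [e, ← h₁, ← h₂]
  simp only [doubleTwistR, Multiset.add_bind, Multiset.insert_eq_cons, ← Multiset.singleton_add,
    Multiset.singleton_bind, RegionNode.ends, mul_zero, zero_add]
  abel

theorem doubleTwist_arcs (p q : ℕ) : (doubleTwistCode p q).arcs =
    (doubleTwistT p q).map Prod.fst + (doubleTwistT p q).map Prod.fst := by
  have h := congrArg (Multiset.map Prod.fst) (doubleTwistR_ends p q)
  rw [Multiset.map_add, Multiset.map_map, Multiset.map_bind] at h
  have e : ∀ v : RegionNode, v.ends.map Prod.fst = v.toNode.arcs := by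
    rintro (_ | _) <;> simp [RegionNode.ends, RegionNode.toNode, Node.arcs]
  simp only [e] at h
  rw [Code.arcs, ← doubleTwistR_toNode, Multiset.bind_map, h]
  rfl

theorem doubleTwistT_nodup (p q : ℕ) : ((doubleTwistT p q).map Prod.fst).Nodup := by
  simp only [doubleTwistT, twistsT, Multiset.map_add, Multiset.map_map, Function.comp_def]
  have key : ∀ k n : ℕ, ((Multiset.range n).map fun i => 4 * i + k).Nodup := fun k n =>
    (Multiset.nodup_range n).map (fun i j h => by simpa using h)
  have key0 : ∀ n : ℕ, ((Multiset.range n).map fun i => 4 * i).Nodup := fun n => key 0 n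
  simp only [Multiset.nodup_add, key, key0, true_and, Multiset.disjoint_left, Multiset.mem_add,
    Multiset.mem_map]
  refine ⟨?_, ?_, ?_⟩
  · rintro _ ⟨i, -, rfl⟩ ⟨j, -, h⟩
    omega
  · rintro _ ⟨i, -, rfl⟩ ⟨j, -, h⟩
    omega
  · rintro _ (⟨i, -, rfl⟩ | ⟨i, -, rfl⟩) (⟨j, -, h⟩ | ⟨j, -, h⟩) <;> omega

theorem doubleTwist_arcsTwice (p q : ℕ) : (doubleTwistCode p q).ArcsTwice := by
  intro a ha
  rw [doubleTwist_arcs] at ha ⊢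
  have h := Multiset.count_eq_one_of_mem (doubleTwistT_nodup p q) (a := a) (by simpa using ha)
  rw [Multiset.count_add, h]

theorem doubleTwist_crossings (p q : ℕ) : (doubleTwistCode p q).crossings = p + q := by
  simp [doubleTwistCode, Code.crossings, twists, Node.crossings, Multiset.map_map,
    Function.comp_def]

theorem doubleTwist_planar (p q : ℕ) : (doubleTwistCode p q).Planar := by
  refine ⟨doubleTwistR p q, doubleTwistT p q, doubleTwistR_toNode p q, doubleTwistR_ends p q, ?_⟩
  rw [doubleTwist_crossings]
  have e : ((doubleTwistT p q).map (fun t => t.2.1) +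
      (doubleTwistT p q).map (fun t => t.2.2)).toFinset =
      (Finset.range (p + 1)).image (fun i => 2 * i) ∪
        (Finset.range (q + 1)).image (fun i => 2 * i + 1) := by
    ext x
    simp only [doubleTwistT, twistsT, Multiset.map_add, Multiset.map_map, Function.comp_def,
      Multiset.mem_toFinset, Multiset.mem_add, Multiset.mem_map, Multiset.mem_range,
      Finset.mem_union, Finset.mem_image, Finset.mem_range]
    constructor
    · rintro (((⟨i, hi, rfl⟩ | ⟨i, hi, rfl⟩) | (⟨i, hi, rfl⟩ | ⟨i, hi, rfl⟩)) |
        ((⟨i, hi, rfl⟩ | ⟨i, hi, rfl⟩) | (⟨i, hi, rfl⟩ | ⟨i, hi, rfl⟩)))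
      · exact Or.inr ⟨0, by omega, rfl⟩
      · exact Or.inl ⟨i, hi, rfl⟩
      · exact Or.inl ⟨0, by omega, rfl⟩
      · exact Or.inr ⟨i, hi, rfl⟩
      · exact Or.inl ⟨i, hi, rfl⟩
      · exact Or.inr ⟨q, by omega, rfl⟩
      · exact Or.inr ⟨i, hi, rfl⟩
      · exact Or.inl ⟨p, by omega, rfl⟩
    · rintro (⟨i, hi, rfl⟩ | ⟨i, hi, rfl⟩)
      · exact Or.inl (Or.inl (Or.inr ⟨i, hi, rfl⟩))
      · exact Or.inl (Or.inr (Or.inr ⟨i, hi, rfl⟩))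
  rw [e, Finset.card_union_of_disjoint, Finset.card_image_of_injective,
    Finset.card_image_of_injective, Finset.card_range, Finset.card_range]
  · omega
  · intro i j h
    simpa using h
  · intro i j h
    simpa using h
  · rw [Finset.disjoint_left]
    simp only [Finset.mem_image]
    rintro _ ⟨i, -, rfl⟩ ⟨j, -, h⟩
    omega

/-- In a twist region with an even number of crossings both strands run from one end to the other
on the same side, and they contain all its arcs. -/
theorem twists_strand (D : Code) (l r : ℕ → ℕ) (n : ℕ) (h : twists l r n ≤ D) :
    ∀ i ≤ n, if Even i
      then Relation.EqvGen D.Strand (l 0) (l i) ∧ Relation.EqvGen D.Strand (r 0) (r i)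
      else Relation.EqvGen D.Strand (l 0) (r i) ∧ Relation.EqvGen D.Strand (r 0) (l i) := by
  have step : ∀ i < n, D.Strand (l i) (r (i + 1)) ∧ D.Strand (r i) (l (i + 1)) := by
    intro i hi
    have hm : Node.cross (l i) (r i) (r (i + 1)) (l (i + 1)) ∈ D :=
      Multiset.mem_of_le h (Multiset.mem_map.2 ⟨i, Multiset.mem_range.2 hi, rfl⟩)
    exact ⟨Or.inl ⟨_, _, hm⟩, Or.inr (Or.inl ⟨_, _, hm⟩)⟩
  intro i
  induction i with
  | zero => intro _; simpa using ⟨Relation.EqvGen.refl _, Relation.EqvGen.refl _⟩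
  | succ i ih =>
    intro hi
    have h₁ := ih (by omega)
    obtain ⟨s, t⟩ := step i (by omega)
    by_cases he : Even i
    · rw [if_pos he] at h₁
      rw [if_neg (by simpa [Nat.even_add_one] using he)]
      exact ⟨h₁.1.trans _ _ _ (.rel _ _ s), h₁.2.trans _ _ _ (.rel _ _ t)⟩
    · rw [if_neg he] at h₁
      rw [if_pos (by simpa [Nat.even_add_one] using he)]
      exact ⟨h₁.1.trans _ _ _ (.rel _ _ t), h₁.2.trans _ _ _ (.rel _ _ s)⟩

theorem doubleTwist_oneComponent (p q : ℕ) (hp : Even p) (hq : Even q) :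
    (doubleTwistCode p q).OneComponent := by
  set D := doubleTwistCode p q with hD
  have hA := twists_strand D (fun i => 4 * i) (fun i => 4 * i + 1) p (by
    rw [hD, doubleTwistCode, add_assoc]; exact Multiset.le_add_right _ _)
  have hB := twists_strand D (fun j => 4 * j + 2) (fun j => 4 * j + 3) q (by
    exact (Multiset.le_add_left _ _).trans (Multiset.le_add_right _ _))
  have s₁ : Relation.EqvGen D.Strand (4 * 0) (4 * 0 + 2) :=
    .rel _ _ (Or.inr (Or.inr (by simp [hD, doubleTwistCode])))
  have s₂ : Relation.EqvGen D.Strand (4 * p) (4 * 0 + 3) :=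
    .rel _ _ (Or.inr (Or.inr (by simp [hD, doubleTwistCode])))
  have s₃ : Relation.EqvGen D.Strand (4 * 0 + 1) (4 * q + 2) :=
    .rel _ _ (Or.inr (Or.inr (by simp [hD, doubleTwistCode])))
  have hAp := hA p le_rfl
  have hBq := hB q le_rfl
  rw [if_pos hp] at hAp
  rw [if_pos hq] at hBq
  have a₁ : Relation.EqvGen D.Strand (4 * 0) (4 * 0 + 1) :=
    (s₁.trans _ _ _ hBq.1).trans _ _ _ (s₃.symm _ _)
  have a₂ : Relation.EqvGen D.Strand (4 * 0) (4 * 0 + 3) := hAp.1.trans _ _ _ s₂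
  have all : ∀ x ∈ D.arcs, Relation.EqvGen D.Strand (4 * 0) x := by
    intro x hx
    rw [hD, doubleTwist_arcs, ← two_nsmul, Multiset.mem_nsmul] at hx
    have hx := hx.2
    simp only [doubleTwistT, twistsT, Multiset.map_add, Multiset.map_map, Function.comp_def,
      Multiset.mem_add, Multiset.mem_map, Multiset.mem_range] at hx
    rcases hx with (⟨i, hi, rfl⟩ | ⟨i, hi, rfl⟩) | (⟨i, hi, rfl⟩ | ⟨i, hi, rfl⟩)
    · have h := hA i (by omega)
      split_ifs at h
      · exact h.1
      · exact a₁.trans _ _ _ h.2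
    · have h := hA i (by omega)
      split_ifs at h
      · exact a₁.trans _ _ _ h.2
      · exact h.1
    · have h := hB i (by omega)
      split_ifs at h
      · exact s₁.trans _ _ _ h.1
      · exact a₂.trans _ _ _ h.2
    · have h := hB i (by omega)
      split_ifs at h
      · exact a₂.trans _ _ _ h.2
      · exact s₁.trans _ _ _ h.1
  intro x hx y hy
  exact ((all x hx).symm _ _).trans _ _ _ (all y hy)

/-- The double twist diagram with `p`, `q` even is a knot diagram. -/
def doubleTwistDiagram (p q : ℕ) (hp : Even p) (hq : Even q) : KnotDiagram where
  code := doubleTwistCode p q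
  arcsTwice := doubleTwist_arcsTwice p q
  oneComponent := doubleTwist_oneComponent p q hp hq
  planar := doubleTwist_planar p q

/-- The double twist knot `K(p, q)`, for `p`, `q` even. -/
def doubleTwistKnot (p q : ℕ) (hp : Even p) (hq : Even q) : Knot :=
  Quot.mk _ (doubleTwistDiagram p q hp hq)

end KnotDiag

/-! The invariant is the Kauffman bracket at loop value 3. With u + u⁻¹ = 3, each crossing is
resolved into its two smoothings with coefficients -u and 1. Since the loop value is the number of
colours, the bracket is a sum over colourings of the arcs by `Fin 3` of products of local weights,
and its behaviour under a Reidemeister move is an identity about the few arcs inside a disc. Every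
move multiplies it by some ±u^k, where the sign and k are the same for both roots u
(`Move.bracket_eq`). Keeping track of this unit replaces a normalisation by the writhe
(`bracket_eq_of_knot_eq`).

Along a row of n half twists one smoothing acts as the identity on the two strands and the other, e,
satisfies e² = 3e. The row is therefore 1 + k e with 1 + 3k = (-u²)^n. Closing up two rows gives
(8(P + Q) + PQ - 8)/3 with P = (-u²)^p and Q = (-u²)^q (`bracket_doubleTwistCode_eq`).

For even p, q and the smaller root u = (3 - √5)/2, P and Q are positive and small, so the bracket
lies so close to -8/3 that the unit relating two such values must be 1. The same sign and exponent
then give the unit 1 at u⁻¹, where P and Q become their inverses. The values at u and u⁻¹ together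
determine {P, Q} (`eq_or_eq_swap_of_eq`), hence {p, q}. The converse exchanges the two discs. -/

namespace KnotDiag

/-! ### Weights of crossings and the local identities behind the Reidemeister moves -/

/-- The Kronecker delta on three colours. -/
def kron (i j : Fin 3) : ℝ := if i = j then 1 else 0

theorem kron_comm (i j : Fin 3) : kron i j = kron j i := by simp [kron, eq_comm]

@[simp] theorem kron_self (i : Fin 3) : kron i i = 1 := by simp [kron]

@[simp] theorem sum_kron_mul (i : Fin 3) (g : Fin 3 → ℝ) : ∑ c, kron i c * g c = g i := by
  simp [kron]

@[simp] theorem sum_kron_mul' (i : Fin 3) (g : Fin 3 → ℝ) : ∑ c, kron c i * g c = g i := by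
  simp [kron]

/-- The weight of a crossing at which the colours `i`, `j`, `k`, `l` meet in counterclockwise
order: a multiple of the Kauffman bracket of the crossing. -/
def crossWeight (u : ℝ) (i j k l : Fin 3) : ℝ :=
  -u * (kron i j * kron k l) + kron i l * kron j k

theorem crossWeight_rotate (u : ℝ) (i j k l : Fin 3) :
    crossWeight u i j k l = crossWeight u k l i j := by
  rw [crossWeight, crossWeight, kron_comm k j, kron_comm i l]
  ring

/-- Each smoothing joins the summed end to exactly one other end, so gluing along one arc is
substitution. This and its variants let products of crossings be expanded one crossing at a time. -/
theorem sum_crossWeight_first (u : ℝ) (j k l : Fin 3) (g : Fin 3 → ℝ) :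
    ∑ c, crossWeight u c j k l * g c = -u * kron k l * g j + kron j k * g l := by
  have h : ∀ c, crossWeight u c j k l * g c =
      -u * kron k l * (kron c j * g c) + kron j k * (kron c l * g c) := fun c => by
    rw [crossWeight]; ring
  simp only [h, Finset.sum_add_distrib, ← Finset.mul_sum, sum_kron_mul']

theorem sum_crossWeight_second (u : ℝ) (i k l : Fin 3) (g : Fin 3 → ℝ) :
    ∑ c, crossWeight u i c k l * g c = -u * kron k l * g i + kron i l * g k := by
  have h : ∀ c, crossWeight u i c k l * g c =
      -u * kron k l * (kron i c * g c) + kron i l * (kron c k * g c) := fun c => by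
    rw [crossWeight]; ring
  simp only [h, Finset.sum_add_distrib, ← Finset.mul_sum, sum_kron_mul', sum_kron_mul]

theorem sum_crossWeight_third (u : ℝ) (i j l : Fin 3) (g : Fin 3 → ℝ) :
    ∑ c, crossWeight u i j c l * g c = -u * kron i j * g l + kron i l * g j := by
  simp only [crossWeight_rotate u i j, sum_crossWeight_first, kron_comm l]

theorem sum_one_colour : ∑ _c : Fin 3, (1 : ℝ) = 3 := by simp

/-- One smoothing leaves the bare strand, the other splits off a loop worth 3: the factor is 3 - u =
u⁻¹. -/
theorem crossWeight_curl {u : ℝ} (hu : u + u⁻¹ = 3) (i k : Fin 3) :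
    ∑ c, crossWeight u i c c k = u⁻¹ * kron i k := by
  have h : ∀ c, crossWeight u i c c k = -u * (kron i c * kron c k) + kron i k * 1 := fun c => by
    rw [crossWeight, kron_self]
  simp only [h, Finset.sum_add_distrib, ← Finset.mul_sum, sum_kron_mul, sum_one_colour]
  linear_combination -kron i k * hu

/-- Here the loop comes with the coefficient -u: the factor is 1 - 3u = -u². -/
theorem crossWeight_curl' {u : ℝ} (h0 : u ≠ 0) (hu : u + u⁻¹ = 3) (i k : Fin 3) :
    ∑ c, crossWeight u c c i k = -u ^ 2 * kron i k := by
  have h : ∀ c, crossWeight u c c i k = -u * kron i k * 1 + kron c k * kron c i := fun c => by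
    rw [crossWeight, kron_self]; ring
  simp only [h, Finset.sum_add_distrib, ← Finset.mul_sum, sum_kron_mul', sum_one_colour]
  rw [kron_comm k]
  linear_combination (u * kron i k) * hu - kron i k * mul_inv_cancel₀ h0

/-- Of the four resolutions three join `a` to `b` and `c` to `d`, with total coefficient u² - 3u + 1
= 0. The fourth one remains. -/
theorem crossWeight_bigon {u : ℝ} (h0 : u ≠ 0) (hu : u + u⁻¹ = 3) (a b c d : Fin 3) :
    ∑ e, ∑ f, crossWeight u a f e b * crossWeight u e f c d = -u * (kron a c * kron b d) := by
  simp only [sum_crossWeight_second]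
  have h : ∀ e, -u * kron e b * crossWeight u e a c d + kron a b * crossWeight u e e c d =
      -u * (kron e b * crossWeight u e a c d) + kron a b * crossWeight u e e c d :=
    fun e => by ring
  simp only [h, Finset.sum_add_distrib, ← Finset.mul_sum, sum_kron_mul', crossWeight_curl' h0 hu]
  rw [crossWeight, kron_comm b a]
  ring

/-- Contracting the three inner arcs in turn leaves terms with at most one crossing. The other side
of the third Reidemeister move is the same expression with the six ends shifted by a half turn, so
one evaluation serves both sides. -/
theorem sum_crossWeight_triangle {u : ℝ} (hu : u + u⁻¹ = 3) (a b c d e f : Fin 3) :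
    ∑ z, ∑ y, ∑ x, crossWeight u a b x y * crossWeight u d z x c * crossWeight u e f y z =
      -u * kron a b * (-u * kron e f * (u⁻¹ * kron d c) + crossWeight u d e f c) +
        (-u * kron b c * crossWeight u e f a d + kron d c * crossWeight u e f a b) := by
  have hx : ∀ z y, ∑ x, crossWeight u a b x y * crossWeight u d z x c * crossWeight u e f y z =
      -u * kron a b * (crossWeight u e f y z * crossWeight u d z y c) +
        kron a y * (crossWeight u d z b c * crossWeight u e f y z) := fun z y => by
    simp only [mul_assoc, sum_crossWeight_third]
    ring
  have hy : ∀ z, ∑ y, ∑ x,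
      crossWeight u a b x y * crossWeight u d z x c * crossWeight u e f y z =
      -u * kron a b * (-u * kron e f * crossWeight u d z z c + kron e z * crossWeight u d z f c) +
        crossWeight u d z b c * crossWeight u e f a z := fun z => by
    simp only [hx, Finset.sum_add_distrib, ← Finset.mul_sum, sum_crossWeight_third, sum_kron_mul]
  simp only [hy, Finset.sum_add_distrib, ← Finset.mul_sum, sum_crossWeight_second, sum_kron_mul,
    crossWeight_curl hu]

theorem crossWeight_triangle {u : ℝ} (h0 : u ≠ 0) (hu : u + u⁻¹ = 3) (a b c d e f : Fin 3) :
    ∑ z, ∑ y, ∑ x, crossWeight u a b x y * crossWeight u d z x c * crossWeight u e f y z =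
    ∑ z, ∑ y, ∑ x, crossWeight u d e x y * crossWeight u a z x f * crossWeight u b c y z := by
  rw [sum_crossWeight_triangle hu, sum_crossWeight_triangle hu]
  simp only [crossWeight, kron_comm b a, kron_comm d a, kron_comm d c, kron_comm e b, kron_comm e d,
    kron_comm f a, kron_comm f c]
  field_simp
  ring

theorem sum_crossWeight_triangle' {u : ℝ} (hu : u + u⁻¹ = 3) (a b c d e f : Fin 3) :
    ∑ z, ∑ y, ∑ x, crossWeight u a b x y * crossWeight u d z x c * crossWeight u f y z e =
      -u * kron a b * (-u * crossWeight u d e f c + kron f e * (u⁻¹ * kron d c)) +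
        (-u * kron b c * crossWeight u f a d e + kron d c * crossWeight u f a b e) := by
  have hx : ∀ z y, ∑ x, crossWeight u a b x y * crossWeight u d z x c * crossWeight u f y z e =
      -u * kron a b * (crossWeight u f y z e * crossWeight u d z y c) +
        kron a y * (crossWeight u d z b c * crossWeight u f y z e) := fun z y => by
    simp only [mul_assoc, sum_crossWeight_third]
    ring
  have hy : ∀ z, ∑ y, ∑ x,
      crossWeight u a b x y * crossWeight u d z x c * crossWeight u f y z e =
      -u * kron a b * (-u * (kron z e * crossWeight u d z f c) + kron f e * crossWeight u d z z c) +
        crossWeight u d z b c * crossWeight u f a z e := fun z => by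
    simp only [hx, Finset.sum_add_distrib, ← Finset.mul_sum, sum_crossWeight_second, sum_kron_mul]
    ring
  simp only [hy, Finset.sum_add_distrib, ← Finset.mul_sum, sum_crossWeight_second, sum_kron_mul',
    crossWeight_curl hu]

theorem crossWeight_triangle' {u : ℝ} (h0 : u ≠ 0) (hu : u + u⁻¹ = 3) (a b c d e f : Fin 3) :
    ∑ z, ∑ y, ∑ x, crossWeight u a b x y * crossWeight u d z x c * crossWeight u f y z e =
    ∑ z, ∑ y, ∑ x, crossWeight u d e x y * crossWeight u a z x f * crossWeight u c y z b := by
  rw [sum_crossWeight_triangle' hu, sum_crossWeight_triangle' hu]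
  simp only [crossWeight, kron_comm c b, kron_comm d a, kron_comm d c, kron_comm e b,
    kron_comm f a, kron_comm f c, kron_comm f e]
  field_simp
  ring

/-! ### The bracket as a state sum over colourings -/

/-- Summation of a function of colourings over the colour of the arc `a`. -/
def sumOut (a : ℕ) (Φ : (ℕ → Fin 3) → ℝ) : (ℕ → Fin 3) → ℝ :=
  fun f => ∑ c, Φ (Function.update f a c)

/-- Sums over the colours of different arcs commute, so `Multiset.foldr` can sum over a multiset of
arcs. -/
instance : LeftCommutative sumOut where
  left_comm a b Φ := by
    by_cases h : a = b
    · rw [h]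
    · funext f
      simp only [sumOut]
      rw [Finset.sum_comm]
      simp only [Function.update_comm (Ne.symm h)]

theorem foldr_sumOut_smul (s : Multiset ℕ) (k : ℝ) (Φ : (ℕ → Fin 3) → ℝ) :
    s.foldr sumOut (k • Φ) = k • s.foldr sumOut Φ := by
  induction s using Multiset.induction_on with
  | empty => simp
  | cons a s ih =>
    rw [Multiset.foldr_cons, Multiset.foldr_cons, ih]
    funext f
    simp [sumOut, Finset.mul_sum]

/-- The weight of a vertex whose arcs are coloured by `f`. -/
def Node.weight (u : ℝ) (f : ℕ → Fin 3) : Node → ℝ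
  | .cross a b c d => crossWeight u (f a) (f b) (f c) (f d)
  | .pt a b => kron (f a) (f b)

/-- The product of the weights of the vertices. -/
def Code.weight (u : ℝ) (D : Code) (f : ℕ → Fin 3) : ℝ := (D.map (Node.weight u f)).prod

/-- The bracket, as a state sum over the colourings of the arcs. -/
def Code.bracket (u : ℝ) (D : Code) : ℝ :=
  D.arcs.dedup.foldr sumOut (D.weight u) fun _ => 0

theorem arcs_cons (v : Node) (R : Code) : Code.arcs (v ::ₘ R) = v.arcs + Code.arcs R :=
  Multiset.cons_bind _ _ _

theorem weight_cons (u : ℝ) (v : Node) (R : Code) (f : ℕ → Fin 3) :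
    Code.weight u (v ::ₘ R) f = v.weight u f * Code.weight u R f := by
  simp [Code.weight]

theorem Node.weight_congr (u : ℝ) {v : Node} {f g : ℕ → Fin 3} (h : ∀ x ∈ v.arcs, f x = g x) :
    v.weight u f = v.weight u g := by
  cases v <;> simp [Node.arcs] at h <;> simp [Node.weight, h]

theorem weight_congr (u : ℝ) {D : Code} {f g : ℕ → Fin 3} (h : ∀ x ∈ D.arcs, f x = g x) :
    D.weight u f = D.weight u g := by
  refine congrArg Multiset.prod (Multiset.map_congr rfl fun v hv => ?_)
  exact v.weight_congr u fun x hx => h x (Multiset.mem_bind.2 ⟨v, hv, hx⟩)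

theorem weight_update (u : ℝ) {D : Code} {x : ℕ} (h : x ∉ D.arcs) (f : ℕ → Fin 3) (c : Fin 3) :
    D.weight u (Function.update f x c) = D.weight u f :=
  weight_congr u fun y hy => Function.update_of_ne (by rintro rfl; exact h hy) _ _

theorem weight_relabel (u : ℝ) (D : Code) (σ : ℕ → ℕ) (f : ℕ → Fin 3) :
    Code.weight u (D.map (Node.relabel σ)) f = D.weight u (f ∘ σ) := by
  rw [Code.weight, Multiset.map_map, Code.weight]
  refine congrArg Multiset.prod (Multiset.map_congr rfl fun v _ => ?_)
  cases v <;> rfl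

theorem arcs_relabel (D : Code) (σ : ℕ → ℕ) :
    Code.arcs (D.map (Node.relabel σ)) = D.arcs.map σ := by
  rw [Code.arcs, Multiset.bind_map, Code.arcs, Multiset.map_bind]
  refine Multiset.bind_congr fun v _ => ?_
  cases v <;> simp [Node.relabel, Node.arcs]

/-- An arc of which two ends are seen has no further ends. -/
theorem Code.ArcsTwice.notMem {D : Code} (h : D.ArcsTwice) {x : ℕ} {s : Multiset ℕ}
    (hs : D.arcs = {x, x} + s) : x ∉ s := by
  have hx := h x (by simp [hs])
  rw [hs, Multiset.count_add] at hx
  rw [← Multiset.count_eq_zero]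
  simpa using hx

/-- Summing out the arcs `s` of a diagram. -/
theorem bracket_eq_mul {u k : ℝ} {D D' : Code} (s : Multiset ℕ)
    (hs : D.arcs.dedup = D'.arcs.dedup + s)
    (h : s.foldr sumOut (D.weight u) = k • D'.weight u) : D.bracket u = k * D'.bracket u := by
  rw [Code.bracket, hs, Multiset.foldr_add, h, foldr_sumOut_smul]
  rfl

/-! ### Behaviour of the bracket under the moves -/

/-- Both ends of `b` are at the curl, so `R` does not involve `b` and the sum over its colour is the
local identity `crossWeight_curl`. The other moves are treated in the same way. -/
theorem bracket_reidemeister1 {u : ℝ} (hu : u + u⁻¹ = 3) (a b c : ℕ) (R : Code)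
    (h : Code.ArcsTwice (Node.cross a b b c ::ₘ R)) :
    Code.bracket u (Node.cross a b b c ::ₘ R) = u⁻¹ * Code.bracket u (Node.pt a c ::ₘ R) := by
  have hne := h.notMem (x := b) (s := {a, c} + Code.arcs R) (by
    simp only [arcs_cons, Node.arcs, Multiset.insert_eq_cons]
    simp only [← Multiset.singleton_add]
    abel)
  simp only [Multiset.insert_eq_cons, Multiset.cons_add, Multiset.singleton_add, Multiset.mem_cons,
    not_or] at hne
  obtain ⟨ha, hc, hR⟩ := hne
  refine bracket_eq_mul {b} ?_ ?_
  · refine (Multiset.Nodup.ext (Multiset.nodup_dedup _) ?_).2 ?_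
    · rw [Multiset.nodup_add]
      simp [arcs_cons, Node.arcs, ha, hc, hR]
    · simp [arcs_cons, Node.arcs]
      grind
  · funext f
    simp [sumOut, weight_cons, weight_update u hR, Node.weight, Ne.symm ha, Ne.symm hc,
      ← Finset.sum_mul, crossWeight_curl hu, mul_assoc]

theorem bracket_reidemeister1' {u : ℝ} (h0 : u ≠ 0) (hu : u + u⁻¹ = 3) (a b c : ℕ) (R : Code)
    (h : Code.ArcsTwice (Node.cross b b a c ::ₘ R)) :
    Code.bracket u (Node.cross b b a c ::ₘ R) = -u ^ 2 * Code.bracket u (Node.pt a c ::ₘ R) := by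
  have hne := h.notMem (x := b) (s := {a, c} + Code.arcs R) (by
    simp only [arcs_cons, Node.arcs, Multiset.insert_eq_cons]
    simp only [← Multiset.singleton_add]
    abel)
  simp only [Multiset.insert_eq_cons, Multiset.cons_add, Multiset.singleton_add, Multiset.mem_cons,
    not_or] at hne
  obtain ⟨ha, hc, hR⟩ := hne
  refine bracket_eq_mul {b} ?_ ?_
  · refine (Multiset.Nodup.ext (Multiset.nodup_dedup _) ?_).2 ?_
    · rw [Multiset.nodup_add]
      simp [arcs_cons, Node.arcs, ha, hc, hR]
    · simp [arcs_cons, Node.arcs]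
      grind
  · funext f
    simp [sumOut, weight_cons, weight_update u hR, Node.weight, Ne.symm ha, Ne.symm hc,
      ← Finset.sum_mul, crossWeight_curl' h0 hu, mul_assoc]

theorem bracket_reidemeister2 {u : ℝ} (h0 : u ≠ 0) (hu : u + u⁻¹ = 3) (a b c d e f : ℕ) (R : Code)
    (h : Code.ArcsTwice ({Node.cross a f e b, Node.cross e f c d} + R)) :
    Code.bracket u ({Node.cross a f e b, Node.cross e f c d} + R) =
      -u * Code.bracket u ({Node.pt a c, Node.pt b d} + R) := by
  simp only [Multiset.insert_eq_cons, Multiset.cons_add, Multiset.singleton_add] at h ⊢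
  have he := h.notMem (x := e) (s := {f, f, a, b, c, d} + Code.arcs R) (by
    simp only [arcs_cons, Node.arcs, Multiset.insert_eq_cons]
    simp only [← Multiset.singleton_add]
    abel)
  have hf := h.notMem (x := f) (s := {e, e, a, b, c, d} + Code.arcs R) (by
    simp only [arcs_cons, Node.arcs, Multiset.insert_eq_cons]
    simp only [← Multiset.singleton_add]
    abel)
  simp only [Multiset.insert_eq_cons, Multiset.cons_add, Multiset.singleton_add, Multiset.mem_cons,
    not_or] at he hf
  obtain ⟨hef, -, ha, hb, hc, hd, hR⟩ := he
  obtain ⟨-, -, ha', hb', hc', hd', hR'⟩ := hf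
  refine bracket_eq_mul {e, f} ?_ ?_
  · refine (Multiset.Nodup.ext (Multiset.nodup_dedup _) ?_).2 ?_
    · rw [Multiset.nodup_add]
      simp [arcs_cons, Node.arcs, ha, hb, hc, hd, ha', hb', hc', hd', hR, hR', hef]
    · simp [arcs_cons, Node.arcs]
      grind
  · funext g
    simp only [Multiset.insert_eq_cons, Multiset.foldr_cons, Multiset.foldr_singleton, sumOut,
      weight_cons, weight_update u hR, weight_update u hR', Node.weight, ← mul_assoc,
      ← Finset.sum_mul, Pi.smul_apply, smul_eq_mul]
    simp [Ne.symm ha, Ne.symm hb, Ne.symm hc, Ne.symm hd, Ne.symm ha', Ne.symm hb', Ne.symm hc',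
      Ne.symm hd', hef, crossWeight_bigon h0 hu, ← mul_assoc]

/-- Summing the delta over the colour of `b` substitutes the colour of `a`, which is what the
renaming of `b` to `a` does. -/
theorem bracket_unmark (u : ℝ) {a b : ℕ} (hab : a ≠ b) (R : Code)
    (h : Code.ArcsTwice (Node.pt a b ::ₘ R)) :
    Code.bracket u (Node.pt a b ::ₘ R) =
      Code.bracket u (R.map (Node.relabel fun x => if x = b then a else x)) := by
  have hb := h b (by simp [arcs_cons, Node.arcs])
  -- As `a ≠ b`, the second end of `b` lies in `R`. This guarantees that `a` is still an arc after
  -- the renaming.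
  have hbR : b ∈ Code.arcs R := by
    rw [← Multiset.count_pos]
    simp [arcs_cons, Node.arcs, Multiset.count_cons] at hb
    grind
  rw [← one_mul (Code.bracket u (R.map _))]
  refine bracket_eq_mul {b} ?_ ?_
  · refine (Multiset.Nodup.ext (Multiset.nodup_dedup _) ?_).2 ?_
    · rw [Multiset.nodup_add]
      simp [arcs_relabel]
      grind
    · simp [arcs_cons, arcs_relabel, Node.arcs]
      grind
  · funext f
    have hf : f ∘ (fun x => if x = b then a else x) = Function.update f b (f a) := by
      funext x
      by_cases hx : x = b <;> simp [hx]
    simp [sumOut, weight_cons, Node.weight, hab, weight_relabel, hf]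

/-- Renaming the summation variables along a permutation. -/
theorem foldr_sumOut_map (σ : Equiv.Perm ℕ) (s : Multiset ℕ) (Φ : (ℕ → Fin 3) → ℝ)
    (f : ℕ → Fin 3) :
    (s.map σ).foldr sumOut (fun g => Φ (g ∘ σ)) f = s.foldr sumOut Φ (f ∘ σ) := by
  induction s using Multiset.induction_on generalizing f with
  | empty => simp
  | cons a s ih =>
    simp only [Multiset.map_cons, Multiset.foldr_cons]
    simp only [sumOut, ih]
    refine Finset.sum_congr rfl fun c _ => congrArg _ ?_
    rw [Function.update_comp_equiv, Equiv.symm_apply_apply]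

theorem bracket_relabel (u : ℝ) (σ : Equiv.Perm ℕ) (D : Code) :
    Code.bracket u (D.map (Node.relabel σ)) = D.bracket u := by
  rw [Code.bracket, arcs_relabel, Multiset.dedup_map_of_injective σ.injective]
  have h : Code.weight u (D.map (Node.relabel σ)) = fun g => D.weight u (g ∘ σ) :=
    funext fun g => weight_relabel u D σ g
  rw [h, foldr_sumOut_map]
  rfl

theorem Node.Same.arcs_eq {v w : Node} (h : Node.Same v w) : v.arcs = w.arcs := by
  cases h with
  | refl => rfl
  | rotate a b c d =>
    simp only [Node.arcs, Multiset.insert_eq_cons, ← Multiset.singleton_add]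
    abel
  | swap a b => exact Multiset.pair_comm a b

theorem Node.Same.weight_eq {v w : Node} (h : Node.Same v w) (u : ℝ) (f : ℕ → Fin 3) :
    v.weight u f = w.weight u f := by
  cases h with
  | refl => rfl
  | rotate a b c d => exact crossWeight_rotate u _ _ _ _
  | swap a b => exact kron_comm _ _

theorem bracket_same (u : ℝ) {D D' : Code} (h : Multiset.Rel Node.Same D D') :
    D.bracket u = D'.bracket u := by
  have key : D.arcs = D'.arcs ∧ D.weight u = D'.weight u := by
    induction h with
    | zero => exact ⟨rfl, rfl⟩
    | cons hv _ ih =>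
      refine ⟨by rw [arcs_cons, arcs_cons, hv.arcs_eq, ih.1], ?_⟩
      funext f
      rw [weight_cons, weight_cons, hv.weight_eq, ih.2]
  rw [Code.bracket, Code.bracket, key.1, key.2]

/-- Two diagrams which agree after the arcs `s` have been summed out. -/
theorem bracket_eq_of_foldr_eq {u : ℝ} {D D' : Code} (t s : Multiset ℕ) (hs : s.Nodup)
    (hd : Disjoint t s) (h₁ : ∀ x, x ∈ D.arcs ↔ x ∈ t + s) (h₂ : ∀ x, x ∈ D'.arcs ↔ x ∈ t + s)
    (h : s.foldr sumOut (D.weight u) = s.foldr sumOut (D'.weight u)) :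
    D.bracket u = D'.bracket u := by
  have key : ∀ C : Code, (∀ x, x ∈ C.arcs ↔ x ∈ t + s) → C.arcs.dedup = t.dedup + s := by
    intro C hC
    refine (Multiset.Nodup.ext (Multiset.nodup_dedup _) ?_).2 fun x => ?_
    · rw [Multiset.nodup_add]
      exact ⟨Multiset.nodup_dedup t, hs,
        Multiset.disjoint_left.2 fun h => Multiset.disjoint_left.1 hd (Multiset.mem_dedup.1 h)⟩
    · rw [Multiset.mem_dedup, hC, Multiset.mem_add, Multiset.mem_add, Multiset.mem_dedup]
  rw [Code.bracket, Code.bracket, key D h₁, key D' h₂, Multiset.foldr_add, Multiset.foldr_add, h]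

theorem bracket_reidemeister3 {u : ℝ} (h0 : u ≠ 0) (hu : u + u⁻¹ = 3)
    (e₁ e₂ e₃ e₄ e₅ e₆ x y z : ℕ) (R : Code)
    (h : Code.ArcsTwice
      ({Node.cross e₁ e₂ x y, Node.cross e₄ z x e₃, Node.cross e₅ e₆ y z} + R)) :
    Code.bracket u ({Node.cross e₁ e₂ x y, Node.cross e₄ z x e₃, Node.cross e₅ e₆ y z} + R) =
      Code.bracket u
        ({Node.cross e₄ e₅ x y, Node.cross e₁ z x e₆, Node.cross e₂ e₃ y z} + R) := by
  simp only [Multiset.insert_eq_cons, Multiset.cons_add, Multiset.singleton_add] at h ⊢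
  -- The sides of the triangle are distinct and have no ends outside it, because both ends of each
  -- are already visible.
  have key : ∀ t : ℕ, t = x ∨ t = y ∨ t = z → t ∉ {e₁, e₂, e₃, e₄, e₅, e₆} + Code.arcs R ∧
      x ≠ y ∧ x ≠ z ∧ y ≠ z := by
    have hx := h.notMem (x := x) (s := {y, y, z, z} + ({e₁, e₂, e₃, e₄, e₅, e₆} + Code.arcs R)) (by
      simp only [arcs_cons, Node.arcs, Multiset.insert_eq_cons]
      simp only [← Multiset.singleton_add]
      abel)
    have hy := h.notMem (x := y) (s := {x, x, z, z} + ({e₁, e₂, e₃, e₄, e₅, e₆} + Code.arcs R)) (by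
      simp only [arcs_cons, Node.arcs, Multiset.insert_eq_cons]
      simp only [← Multiset.singleton_add]
      abel)
    have hz := h.notMem (x := z) (s := {x, x, y, y} + ({e₁, e₂, e₃, e₄, e₅, e₆} + Code.arcs R)) (by
      simp only [arcs_cons, Node.arcs, Multiset.insert_eq_cons]
      simp only [← Multiset.singleton_add]
      abel)
    rw [Multiset.mem_add] at hx hy hz
    push Not at hx hy hz
    have hxy : x ≠ y := by rintro rfl; simp at hx
    have hxz : x ≠ z := by rintro rfl; simp at hx
    have hyz : y ≠ z := by rintro rfl; simp at hy
    rintro t (rfl | rfl | rfl)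
    exacts [⟨hx.2, hxy, hxz, hyz⟩, ⟨hy.2, hxy, hxz, hyz⟩, ⟨hz.2, hxy, hxz, hyz⟩]
  obtain ⟨hx, hxy, hxz, hyz⟩ := key x (by simp)
  have hy := (key y (by simp)).1
  have hz := (key z (by simp)).1
  clear key h
  -- The inner arcs are summed first; the remaining arcs are common to both diagrams.
  refine bracket_eq_of_foldr_eq ({e₁, e₂, e₃, e₄, e₅, e₆} + Code.arcs R) {z, y, x} ?_ ?_ ?_ ?_ ?_
  · simp [hxy.symm, hxz.symm, hyz.symm]
  · simp only [Multiset.insert_eq_cons, Multiset.disjoint_left, Multiset.mem_cons,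
      Multiset.mem_singleton] at hx hy hz ⊢
    grind
  · simp [arcs_cons, Node.arcs]
    grind
  · simp [arcs_cons, Node.arcs]
    grind
  · simp only [Multiset.insert_eq_cons, Multiset.cons_add, Multiset.singleton_add,
      Multiset.mem_cons, not_or] at hx hy hz
    funext f
    simp only [Multiset.insert_eq_cons, Multiset.foldr_cons, Multiset.foldr_singleton, sumOut,
      weight_cons, weight_update u hx.2.2.2.2.2.2, weight_update u hy.2.2.2.2.2.2,
      weight_update u hz.2.2.2.2.2.2, Node.weight, ← mul_assoc, ← Finset.sum_mul]
    congr 1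
    simp only [Function.update_self, ne_eq, hxy.symm, hxz.symm, hyz.symm,
      not_false_eq_true, Function.update_of_ne, Ne.symm hx.1, Ne.symm hx.2.1, Ne.symm hx.2.2.1,
      Ne.symm hx.2.2.2.1, Ne.symm hx.2.2.2.2.1, Ne.symm hx.2.2.2.2.2.1,
      Ne.symm hy.1, Ne.symm hy.2.1, Ne.symm hy.2.2.1,
      Ne.symm hy.2.2.2.1, Ne.symm hy.2.2.2.2.1, Ne.symm hy.2.2.2.2.2.1,
      Ne.symm hz.1, Ne.symm hz.2.1, Ne.symm hz.2.2.1,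
      Ne.symm hz.2.2.2.1, Ne.symm hz.2.2.2.2.1, Ne.symm hz.2.2.2.2.2.1]
    exact crossWeight_triangle h0 hu _ _ _ _ _ _

theorem bracket_reidemeister3' {u : ℝ} (h0 : u ≠ 0) (hu : u + u⁻¹ = 3)
    (e₁ e₂ e₃ e₄ e₅ e₆ x y z : ℕ) (R : Code)
    (h : Code.ArcsTwice
      ({Node.cross e₁ e₂ x y, Node.cross e₄ z x e₃, Node.cross e₆ y z e₅} + R)) :
    Code.bracket u ({Node.cross e₁ e₂ x y, Node.cross e₄ z x e₃, Node.cross e₆ y z e₅} + R) =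
      Code.bracket u
        ({Node.cross e₄ e₅ x y, Node.cross e₁ z x e₆, Node.cross e₃ y z e₂} + R) := by
  simp only [Multiset.insert_eq_cons, Multiset.cons_add, Multiset.singleton_add] at h ⊢
  have key : ∀ t : ℕ, t = x ∨ t = y ∨ t = z → t ∉ {e₁, e₂, e₃, e₄, e₅, e₆} + Code.arcs R ∧
      x ≠ y ∧ x ≠ z ∧ y ≠ z := by
    have hx := h.notMem (x := x) (s := {y, y, z, z} + ({e₁, e₂, e₃, e₄, e₅, e₆} + Code.arcs R)) (by
      simp only [arcs_cons, Node.arcs, Multiset.insert_eq_cons]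
      simp only [← Multiset.singleton_add]
      abel)
    have hy := h.notMem (x := y) (s := {x, x, z, z} + ({e₁, e₂, e₃, e₄, e₅, e₆} + Code.arcs R)) (by
      simp only [arcs_cons, Node.arcs, Multiset.insert_eq_cons]
      simp only [← Multiset.singleton_add]
      abel)
    have hz := h.notMem (x := z) (s := {x, x, y, y} + ({e₁, e₂, e₃, e₄, e₅, e₆} + Code.arcs R)) (by
      simp only [arcs_cons, Node.arcs, Multiset.insert_eq_cons]
      simp only [← Multiset.singleton_add]
      abel)
    rw [Multiset.mem_add] at hx hy hz
    push Not at hx hy hz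
    have hxy : x ≠ y := by rintro rfl; simp at hx
    have hxz : x ≠ z := by rintro rfl; simp at hx
    have hyz : y ≠ z := by rintro rfl; simp at hy
    rintro t (rfl | rfl | rfl)
    exacts [⟨hx.2, hxy, hxz, hyz⟩, ⟨hy.2, hxy, hxz, hyz⟩, ⟨hz.2, hxy, hxz, hyz⟩]
  obtain ⟨hx, hxy, hxz, hyz⟩ := key x (by simp)
  have hy := (key y (by simp)).1
  have hz := (key z (by simp)).1
  clear key h
  refine bracket_eq_of_foldr_eq ({e₁, e₂, e₃, e₄, e₅, e₆} + Code.arcs R) {z, y, x} ?_ ?_ ?_ ?_ ?_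
  · simp [hxy.symm, hxz.symm, hyz.symm]
  · simp only [Multiset.insert_eq_cons, Multiset.disjoint_left, Multiset.mem_cons,
      Multiset.mem_singleton] at hx hy hz ⊢
    grind
  · simp [arcs_cons, Node.arcs]
    grind
  · simp [arcs_cons, Node.arcs]
    grind
  · simp only [Multiset.insert_eq_cons, Multiset.cons_add, Multiset.singleton_add,
      Multiset.mem_cons, not_or] at hx hy hz
    funext f
    simp only [Multiset.insert_eq_cons, Multiset.foldr_cons, Multiset.foldr_singleton, sumOut,
      weight_cons, weight_update u hx.2.2.2.2.2.2, weight_update u hy.2.2.2.2.2.2,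
      weight_update u hz.2.2.2.2.2.2, Node.weight, ← mul_assoc, ← Finset.sum_mul]
    congr 1
    simp only [Function.update_self, ne_eq, hxy.symm, hxz.symm, hyz.symm,
      not_false_eq_true, Function.update_of_ne, Ne.symm hx.1, Ne.symm hx.2.1, Ne.symm hx.2.2.1,
      Ne.symm hx.2.2.2.1, Ne.symm hx.2.2.2.2.1, Ne.symm hx.2.2.2.2.2.1,
      Ne.symm hy.1, Ne.symm hy.2.1, Ne.symm hy.2.2.1,
      Ne.symm hy.2.2.2.1, Ne.symm hy.2.2.2.2.1, Ne.symm hy.2.2.2.2.2.1,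
      Ne.symm hz.1, Ne.symm hz.2.1, Ne.symm hz.2.2.1,
      Ne.symm hz.2.2.2.1, Ne.symm hz.2.2.2.2.1, Ne.symm hz.2.2.2.2.2.1]
    exact crossWeight_triangle' h0 hu _ _ _ _ _ _

/-- A move multiplies the bracket by a unit that is given by the same expression for all `u`. -/
theorem Move.bracket_eq {D D' : Code} (h : Move D D') (hD : D.ArcsTwice) :
    ∃ (s : ℤˣ) (k : ℤ), ∀ u : ℝ, u ≠ 0 → u + u⁻¹ = 3 →
      D.bracket u = (s : ℤ) * u ^ k * D'.bracket u := by
  cases h with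
  | rename σ h =>
    refine ⟨1, 0, fun u _ _ => ?_⟩
    rw [← bracket_same u h, bracket_relabel]
    simp
  | unmark h R =>
    refine ⟨1, 0, fun u _ _ => ?_⟩
    rw [bracket_unmark u h R hD]
    simp
  | reidemeister1 a b c R =>
    refine ⟨1, -1, fun u _ hu => ?_⟩
    rw [bracket_reidemeister1 hu a b c R hD]
    simp
  | reidemeister1' a b c R =>
    refine ⟨-1, 2, fun u h0 hu => ?_⟩
    rw [bracket_reidemeister1' h0 hu a b c R hD, show (2 : ℤ) = (2 : ℕ) from rfl, zpow_natCast]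
    simp
  | reidemeister2 a b c d e f R =>
    refine ⟨-1, 1, fun u h0 hu => ?_⟩
    rw [bracket_reidemeister2 h0 hu a b c d e f R hD]
    simp
  | reidemeister3 e₁ e₂ e₃ e₄ e₅ e₆ x y z R =>
    refine ⟨1, 0, fun u h0 hu => ?_⟩
    rw [bracket_reidemeister3 h0 hu e₁ e₂ e₃ e₄ e₅ e₆ x y z R hD]
    simp
  | reidemeister3' e₁ e₂ e₃ e₄ e₅ e₆ x y z R =>
    refine ⟨1, 0, fun u h0 hu => ?_⟩
    rw [bracket_reidemeister3' h0 hu e₁ e₂ e₃ e₄ e₅ e₆ x y z R hD]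
    simp

/-- Diagrams of the same knot have the same bracket up to a unit. -/
theorem bracket_eq_of_knot_eq {D D' : KnotDiagram}
    (h : (Quot.mk _ D : Knot) = Quot.mk _ D') :
    ∃ (s : ℤˣ) (k : ℤ), ∀ u : ℝ, u ≠ 0 → u + u⁻¹ = 3 →
      D.code.bracket u = (s : ℤ) * u ^ k * D'.code.bracket u := by
  replace h := Quot.eqvGen_exact h
  induction h with
  -- All intermediate codes come from knot diagrams, so `ArcsTwice` is available at every move.
  | rel D D' h => exact h.bracket_eq D.arcsTwice
  | refl D => exact ⟨1, 0, fun u _ _ => by simp⟩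
  | symm D D' _ ih =>
    obtain ⟨s, k, ih⟩ := ih
    refine ⟨s, -k, fun u h0 hu => ?_⟩
    have hs : ((s : ℤ) : ℝ) * (s : ℤ) = 1 := by
      rcases Int.units_eq_one_or s with rfl | rfl <;> simp
    rw [ih u h0 hu]
    have hk : u ^ (-k) * u ^ k = 1 := by rw [← zpow_add₀ h0]; simp
    linear_combination (-(D'.code.bracket u)) * hs -
      (s : ℤ) * (s : ℤ) * (D'.code.bracket u) * hk
  | trans D D' D'' _ _ ih₁ ih₂ =>
    obtain ⟨s, k, ih₁⟩ := ih₁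
    obtain ⟨s', k', ih₂⟩ := ih₂
    refine ⟨s * s', k + k', fun u h0 hu => ?_⟩
    rw [ih₁ u h0 hu, ih₂ u h0 hu, zpow_add₀ h0]
    push_cast
    ring

/-! ### Rows of half twists and the bracket of the double twist diagram -/

/-- The weight of a twist region, up to a factor, as a combination of the two smoothings. -/
def twistWeight (k : ℝ) (i j i' j' : Fin 3) : ℝ :=
  k * (kron i j * kron i' j') + kron i j' * kron j i'

/-- With e² = 3e, (1 + k e)(1 + k' e) = 1 + (k + k' + 3kk') e. -/
theorem twistWeight_comp (k k' : ℝ) (i j i' j' : Fin 3) :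
    ∑ s, ∑ t, twistWeight k i j t s * twistWeight k' s t i' j' =
      twistWeight (k + k' + 3 * k * k') i j i' j' := by
  have ht : ∀ s, ∑ t, twistWeight k i j t s * twistWeight k' s t i' j' =
      k * kron i j * twistWeight k' s s i' j' + kron i s * twistWeight k' s j i' j' := fun s => by
    have h : ∀ t, twistWeight k i j t s * twistWeight k' s t i' j' =
        k * kron i j * (kron t s * twistWeight k' s t i' j') +
          kron i s * (kron j t * twistWeight k' s t i' j') := fun t => by
      rw [twistWeight]; ring
    simp only [h, Finset.sum_add_distrib, ← Finset.mul_sum, sum_kron_mul, sum_kron_mul']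
  have hs : ∑ s, twistWeight k' s s i' j' = (1 + 3 * k') * kron i' j' := by
    have h : ∀ s, twistWeight k' s s i' j' = k' * kron i' j' * 1 + kron s j' * kron s i' :=
      fun s => by rw [twistWeight, kron_self]; ring
    simp only [h, Finset.sum_add_distrib, ← Finset.mul_sum, sum_kron_mul', sum_one_colour]
    rw [kron_comm j']
    ring
  simp only [ht, Finset.sum_add_distrib, ← Finset.mul_sum, sum_kron_mul, hs]
  rw [twistWeight, twistWeight]
  ring

/-- The coefficient of the nontrivial smoothing in a row of `n` half twists. -/
noncomputable def twistCoeff (u : ℝ) (n : ℕ) : ℝ := ((-u ^ 2) ^ n - 1) / 3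

/-- The case n = 1: (-u² - 1)/3 = -u because u² + 1 = 3u. -/
theorem crossWeight_eq_twistWeight {u : ℝ} (h0 : u ≠ 0) (hu : u + u⁻¹ = 3) (i j k l : Fin 3) :
    crossWeight u i j k l = twistWeight (twistCoeff u 1) i j k l := by
  have h : twistCoeff u 1 = -u := by
    rw [twistCoeff]
    linear_combination (-u / 3) * hu + mul_inv_cancel₀ h0 / 3
  rw [h]
  rfl

/-- The quantity 1 + 3 `twistCoeff u n` = (-u²)^n is multiplicative in n. -/
theorem twistCoeff_add (u : ℝ) (m n : ℕ) :
    twistCoeff u (m + n) = twistCoeff u m + twistCoeff u n + 3 * twistCoeff u m * twistCoeff u n := by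
  simp only [twistCoeff, pow_add]
  ring

theorem weight_add (u : ℝ) (D D' : Code) (f : ℕ → Fin 3) :
    Code.weight u (D + D') f = D.weight u f * D'.weight u f := by
  simp [Code.weight]

theorem weight_twists_succ (u : ℝ) (l r : ℕ → ℕ) (n : ℕ) (f : ℕ → Fin 3) :
    (twists l r (n + 1)).weight u f =
      crossWeight u (f (l n)) (f (r n)) (f (r (n + 1))) (f (l (n + 1))) *
        (twists l r n).weight u f := by
  rw [twists, Multiset.range_succ, Multiset.map_cons, weight_cons]
  rfl

/-- The arcs in the interior of a row of `n + 1` half twists. -/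
def innerArcs (l r : ℕ → ℕ) (n : ℕ) : Multiset ℕ :=
  (Multiset.range n).bind fun i => {l (i + 1), r (i + 1)}

/-- `Ψ` stands for the rest of the diagram, which does not involve the interior arcs of the row. -/
theorem foldr_innerArcs {u : ℝ} (h0 : u ≠ 0) (hu : u + u⁻¹ = 3) {l r : ℕ → ℕ}
    (hl : Function.Injective l) (hr : Function.Injective r) (hlr : ∀ i j, l i ≠ r j) (n : ℕ)
    (Ψ : (ℕ → Fin 3) → ℝ)
    (hΨ : ∀ i < n, ∀ f c, Ψ (Function.update f (l (i + 1)) c) = Ψ f ∧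
      Ψ (Function.update f (r (i + 1)) c) = Ψ f) :
    (innerArcs l r n).foldr sumOut (fun f => (twists l r (n + 1)).weight u f * Ψ f) =
      fun f => twistWeight (twistCoeff u (n + 1)) (f (l 0)) (f (r 0)) (f (r (n + 1)))
        (f (l (n + 1))) * Ψ f := by
  induction n generalizing Ψ with
  | zero =>
    funext f
    simp [innerArcs, ← crossWeight_eq_twistWeight h0 hu, twists, Code.weight, Node.weight]
  | succ n ih =>
    have hl' : ∀ {i j}, i ≠ j → l i ≠ l j := fun h => hl.ne h
    have hr' : ∀ {i j}, i ≠ j → r i ≠ r j := fun h => hr.ne h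
    have hrl : ∀ i j, r i ≠ l j := fun i j => (hlr j i).symm
    -- The last crossing is absorbed into `Ψ`, so that the induction hypothesis applies to the
    -- shorter row.
    have e : (fun f => (twists l r (n + 1 + 1)).weight u f * Ψ f) =
        fun f => (twists l r (n + 1)).weight u f *
          (crossWeight u (f (l (n + 1))) (f (r (n + 1))) (f (r (n + 2))) (f (l (n + 2))) * Ψ f) := by
      funext f
      rw [weight_twists_succ]
      ring
    rw [e, innerArcs, Multiset.range_succ, Multiset.cons_bind, Multiset.foldr_add, ← innerArcs,
      ih]
    · funext f
      simp only [Multiset.insert_eq_cons, Multiset.foldr_cons, Multiset.foldr_singleton, sumOut,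
        (hΨ n n.lt_succ_self _ _).1, (hΨ n n.lt_succ_self _ _).2]
      simp only [← mul_assoc, ← Finset.sum_mul]
      congr 1
      simp only [Function.update_self, ne_eq, hlr, hrl, not_false_eq_true, Function.update_of_ne,
        hl.eq_iff, hr.eq_iff, Nat.add_eq_zero_iff, one_ne_zero, and_false,
        right_eq_add, add_right_inj, OfNat.ofNat_ne_one,
        crossWeight_eq_twistWeight h0 hu]
      rw [twistWeight_comp, ← twistCoeff_add]
    · intro i hi f c
      have h := hΨ i (by omega) f c
      rw [h.1, h.2]
      constructor
      · rw [Function.update_of_ne (hl' (by omega)), Function.update_of_ne (hl' (by omega)),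
          Function.update_of_ne (hrl _ _), Function.update_of_ne (hrl _ _)]
      · rw [Function.update_of_ne (hr' (by omega)), Function.update_of_ne (hr' (by omega)),
          Function.update_of_ne (hlr _ _), Function.update_of_ne (hlr _ _)]

/-- The four pairs of smoothings close up to 1, 2, 2 and 1 loops, each loop worth 3. -/
theorem sum_twistWeight_closure (k k' : ℝ) :
    ∑ a, ∑ b, ∑ c, ∑ d, ∑ a', ∑ b', ∑ c', ∑ d', twistWeight k a b d c *
      (twistWeight k' a' b' d' c' * (kron a a' * (kron c b' * (kron b c' * kron d d')))) =
      3 + 9 * k + 9 * k' + 3 * k * k' := by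
  have h₁ : ∀ a b c d, ∑ a', ∑ b', ∑ c', ∑ d', twistWeight k a b d c *
      (twistWeight k' a' b' d' c' * (kron a a' * (kron c b' * (kron b c' * kron d d')))) =
      twistWeight k a b d c * twistWeight k' a c d b := by
    intro a b c d
    have h : ∀ a' b' c' d', twistWeight k a b d c *
      (twistWeight k' a' b' d' c' * (kron a a' * (kron c b' * (kron b c' * kron d d')))) =
      twistWeight k a b d c * (kron a a' * (kron c b' * (kron b c' *
        (kron d d' * twistWeight k' a' b' d' c')))) := fun _ _ _ _ => by ring
    simp only [h, ← Finset.mul_sum, sum_kron_mul]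
  simp only [h₁]
  simp [twistWeight, kron, Fin.sum_univ_three]
  ring

theorem bracket_doubleTwistCode {u : ℝ} (h0 : u ≠ 0) (hu : u + u⁻¹ = 3) (p q : ℕ) :
    (doubleTwistCode (p + 1) (q + 1)).bracket u =
      3 + 9 * twistCoeff u (p + 1) + 9 * twistCoeff u (q + 1) +
        3 * twistCoeff u (p + 1) * twistCoeff u (q + 1) := by
  set l : ℕ → ℕ := fun i => 4 * i with hl
  set r : ℕ → ℕ := fun i => 4 * i + 1 with hr
  set l' : ℕ → ℕ := fun i => 4 * i + 2 with hl'
  set r' : ℕ → ℕ := fun i => 4 * i + 3 with hr'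
  -- The eight arcs at the marked points, distinct since both rows have a crossing, in the order of
  -- the sums in `sum_twistWeight_closure`.
  set B : Multiset ℕ :=
    {l 0, r 0, l (p + 1), r (p + 1), l' 0, r' 0, l' (q + 1), r' (q + 1)} with hB
  have harcs : (doubleTwistCode (p + 1) (q + 1)).arcs.dedup =
      B + (innerArcs l r p + innerArcs l' r' q) := by
    have hT : (doubleTwistCode (p + 1) (q + 1)).arcs.dedup =
        (doubleTwistT (p + 1) (q + 1)).map Prod.fst := by
      refine (Multiset.Nodup.ext (Multiset.nodup_dedup _) (doubleTwistT_nodup _ _)).2 fun x => ?_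
      rw [Multiset.mem_dedup, doubleTwist_arcs, Multiset.mem_add, or_self]
    have hM : ∀ g : ℕ → ℕ, ∀ n : ℕ, (Multiset.range (n + 1 + 1)).map g =
        {g 0, g (n + 1)} + (Multiset.range n).map fun i => g (i + 1) := by
      intro g n
      rw [Multiset.range_succ, Multiset.map_cons]
      have h : (Multiset.range (n + 1)).map g =
          g 0 ::ₘ (Multiset.range n).map fun i => g (i + 1) := by
        induction n with
        | zero => rfl
        | succ n ih =>
          rw [Multiset.range_succ, Multiset.map_cons, ih, Multiset.range_succ, Multiset.map_cons,
            Multiset.cons_swap]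
      rw [h, Multiset.insert_eq_cons, Multiset.cons_add, Multiset.singleton_add,
        Multiset.cons_swap]
    rw [hT]
    simp only [doubleTwistT, twistsT, Multiset.map_add, Multiset.map_map, Function.comp_def, hM,
      innerArcs, Multiset.insert_eq_cons, ← Multiset.singleton_add, Multiset.bind_add,
      Multiset.bind_singleton, hB, hl, hr, hl', hr']
    abel
  have hw : (doubleTwistCode (p + 1) (q + 1)).weight u = fun f =>
      (twists l' r' (q + 1)).weight u f * ((twists l r (p + 1)).weight u f *
        (kron (f (l 0)) (f (l' 0)) * (kron (f (l (p + 1))) (f (r' 0)) *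
          (kron (f (r 0)) (f (l' (q + 1))) * kron (f (r (p + 1))) (f (r' (q + 1))))))) := by
    funext f
    rw [doubleTwistCode, weight_add, weight_add]
    simp only [Multiset.insert_eq_cons, weight_cons, Node.weight]
    simp only [Code.weight, Multiset.map_singleton, Multiset.prod_singleton, Node.weight]
    ring
  rw [Code.bracket, harcs, Multiset.foldr_add, Multiset.foldr_add, hw,
    foldr_innerArcs h0 hu (l := l') (r := r') (fun i j h => by simpa [hl'] using h)
      (fun i j h => by simpa [hr'] using h) (fun i j => by simp only [hl', hr']; omega) q
      (fun f => (twists l r (p + 1)).weight u f *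
      (kron (f (l 0)) (f (l' 0)) * (kron (f (l (p + 1))) (f (r' 0)) *
      (kron (f (r 0)) (f (l' (q + 1))) * kron (f (r (p + 1))) (f (r' (q + 1)))))))]
  -- The second row is already collapsed; its weight now joins the factor `Ψ` for the first row.
  · simp only [mul_left_comm _ (Code.weight u (twists l r (p + 1)) _)]
    rw [foldr_innerArcs h0 hu (l := l) (r := r) (fun i j h => by simpa [hl] using h)
      (fun i j h => by simpa [hr] using h) (fun i j => by simp only [hl, hr]; omega) p]
    · have hd : B.Nodup := by
        rw [hB]
        simp [hl, hr, hl', hr']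
        omega
      rw [← sum_twistWeight_closure]
      simp only [hB, Multiset.insert_eq_cons, Multiset.nodup_cons, Multiset.mem_cons,
        Multiset.mem_singleton, not_or] at hd
      simp only [hB, Multiset.insert_eq_cons, Multiset.foldr_cons, Multiset.foldr_singleton,
        sumOut, Function.update_self, ne_eq, hd, not_false_eq_true, Function.update_of_ne]
    · intro i hi f c
      have hx : ∀ x, x = l (i + 1) ∨ x = r (i + 1) → l 0 ≠ x ∧ r 0 ≠ x ∧ l (p + 1) ≠ x ∧
          r (p + 1) ≠ x ∧ l' 0 ≠ x ∧ r' 0 ≠ x ∧ l' (q + 1) ≠ x ∧ r' (q + 1) ≠ x := by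
        simp only [hl, hr, hl', hr']
        omega
      have hl := hx _ (Or.inl rfl)
      have hr := hx _ (Or.inr rfl)
      constructor <;> simp only [ne_eq, hl, hr, not_false_eq_true, Function.update_of_ne]
  · intro i hi f c
    have hx : ∀ x, x = l' (i + 1) ∨ x = r' (i + 1) → l 0 ≠ x ∧ r 0 ≠ x ∧ l (p + 1) ≠ x ∧
        r (p + 1) ≠ x ∧ l' 0 ≠ x ∧ r' 0 ≠ x ∧ l' (q + 1) ≠ x ∧ r' (q + 1) ≠ x := by
      simp only [hl, hr, hl', hr']
      omega
    have hm : ∀ x, x = l' (i + 1) ∨ x = r' (i + 1) → x ∉ (twists l r (p + 1)).arcs := by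
      intro x hx h
      simp only [twists, Code.arcs, Multiset.bind_map, Multiset.mem_bind, Node.arcs,
        Multiset.insert_eq_cons, Multiset.mem_cons, Multiset.mem_singleton] at h
      obtain ⟨j, -, h⟩ := h
      simp only [hl, hr, hl', hr'] at hx h
      omega
    have hL := hx _ (Or.inl rfl)
    have hR := hx _ (Or.inr rfl)
    constructor <;> simp only [weight_update u (hm _ (Or.inl rfl)),
      weight_update u (hm _ (Or.inr rfl)), ne_eq, hL, hR, not_false_eq_true, Function.update_of_ne]

/-- The bracket of the double twist diagram in terms of `P = (-u ^ 2) ^ p` and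
`Q = (-u ^ 2) ^ q`. -/
theorem bracket_doubleTwistCode_eq {u : ℝ} (h0 : u ≠ 0) (hu : u + u⁻¹ = 3) {p q : ℕ}
    (hp : 0 < p) (hq : 0 < q) :
    (doubleTwistCode p q).bracket u =
      (8 * ((-u ^ 2) ^ p + (-u ^ 2) ^ q) + (-u ^ 2) ^ p * (-u ^ 2) ^ q - 8) / 3 := by
  obtain ⟨p, rfl⟩ := Nat.exists_eq_succ_of_ne_zero hp.ne'
  obtain ⟨q, rfl⟩ := Nat.exists_eq_succ_of_ne_zero hq.ne'
  rw [Nat.succ_eq_add_one, Nat.succ_eq_add_one, bracket_doubleTwistCode h0 hu, twistCoeff,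
    twistCoeff]
  ring

/-! ### Recovering the numbers of half twists from the bracket -/

/-- The first bound excludes k ≥ 1, the second k ≤ -1. -/
theorem zpow_eq_one_of_bounds {u : ℝ} (h0 : 0 < u) (h1 : u < 1) {k : ℤ} (hl : u < u ^ k)
    (hr : u ^ k * u < 1) : u ^ k = 1 := by
  rcases lt_trichotomy k 0 with hk | rfl | hk
  · rw [← zpow_add_one₀ h0.ne'] at hr
    have := one_le_zpow_of_nonpos₀ h0 h1.le (show k + 1 ≤ 0 by omega)
    linarith
  · exact zpow_zero u
  · have := zpow_le_zpow_right_of_le_one₀ h0 h1.le (show 1 ≤ k by omega)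
    rw [zpow_one] at this
    linarith

/-- Two numbers are determined by their values of `8 * (P + Q) + P * Q`, for them and for their
inverses. -/
theorem eq_or_eq_swap_of_eq {P Q A B : ℝ} (hP : 0 < P) (hQ : 0 < Q) (hA : 0 < A) (hB : 0 < B)
    (h : 8 * (P + Q) + P * Q = 8 * (A + B) + A * B)
    (h' : 8 * (P⁻¹ + Q⁻¹) + P⁻¹ * Q⁻¹ = 8 * (A⁻¹ + B⁻¹) + A⁻¹ * B⁻¹) :
    P = A ∧ Q = B ∨ P = B ∧ Q = A := by
  have h₂ : (8 * (P + Q) + 1) * (A * B) = (8 * (A + B) + 1) * (P * Q) := by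
    field_simp at h'
    linear_combination h'
  have hmul : P * Q = A * B := by
    -- Eliminating A + B leaves the difference of the products times a positive factor.
    have e : (P * Q - A * B) * (8 * (P + Q) + P * Q + 1) = 0 := by
      linear_combination (P * Q) * h - h₂
    have hpos : 8 * (P + Q) + P * Q + 1 ≠ 0 := by positivity
    linarith [(mul_eq_zero.1 e).resolve_right hpos]
  have hadd : P + Q = A + B := by linarith
  have e : (P - A) * (P - B) = 0 := by linear_combination P * hadd - hmul
  rcases mul_eq_zero.1 e with e | e
  · exact Or.inl ⟨by linarith, by linarith⟩
  · exact Or.inr ⟨by linarith, by linarith⟩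

/-- All values are negative and any two have a ratio below 4/3, which leaves no room for a sign or a
nontrivial power of u. -/
theorem bracket_doubleTwistCode_bounds {u : ℝ} (h0 : 0 < u) (h1 : u < 2 / 5) (hu : u + u⁻¹ = 3)
    {p q : ℕ} (hp : Even p) (hq : Even q) (p_pos : 0 < p) (q_pos : 0 < q) :
    -(8 / 3) < (doubleTwistCode p q).bracket u ∧ (doubleTwistCode p q).bracket u < -2 := by
  -- Evenness makes the power positive and gives n ≥ 2, so it is at most u⁴ < 16/625 < 1/36.
  have hP : ∀ n : ℕ, Even n → 0 < n → 0 < (-u ^ 2) ^ n ∧ (-u ^ 2) ^ n < 1 / 36 := by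
    intro n hn n_pos
    rw [hn.neg_pow]
    refine ⟨by positivity, ?_⟩
    have ht : u ^ 2 < 4 / 25 := by nlinarith
    have h2 : 2 ≤ n := by obtain ⟨m, rfl⟩ := hn; omega
    have := pow_le_pow_of_le_one (sq_nonneg u) (by linarith) h2
    nlinarith [sq_nonneg u]
  obtain ⟨hP0, hP1⟩ := hP p hp p_pos
  obtain ⟨hQ0, hQ1⟩ := hP q hq q_pos
  rw [bracket_doubleTwistCode_eq h0.ne' hu p_pos q_pos]
  constructor <;> nlinarith [mul_pos hP0 hQ0]

/-- Exchanging the arc names of the two discs turns one code into the other, except that the two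
arcs at each marked point are listed in the opposite order. -/
theorem doubleTwistKnot_comm (p q : ℕ) (hp : Even p) (hq : Even q) :
    doubleTwistKnot p q hp hq = doubleTwistKnot q p hq hp := by
  have hσ : Function.Involutive fun x : ℕ => if x % 4 < 2 then x + 2 else x - 2 := by
    intro x
    dsimp only
    split_ifs <;> omega
  refine Quot.sound (Move.rename (hσ.toPerm _) ?_)
  have h0 : ∀ i, (hσ.toPerm _) (4 * i) = 4 * i + 2 := fun i => if_pos (by omega)
  have h1 : ∀ i, (hσ.toPerm _) (4 * i + 1) = 4 * i + 3 := fun i => if_pos (by omega)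
  have h2 : ∀ i, (hσ.toPerm _) (4 * i + 2) = 4 * i := fun i => if_neg (by omega)
  have h3 : ∀ i, (hσ.toPerm _) (4 * i + 3) = 4 * i + 1 := fun i => if_neg (by omega)
  have ht : ∀ (l r l' r' : ℕ → ℕ) (n : ℕ), (∀ i, (hσ.toPerm _) (l i) = l' i) →
      (∀ i, (hσ.toPerm _) (r i) = r' i) →
      (twists l r n).map (Node.relabel (hσ.toPerm _)) = twists l' r' n := by
    intro l r l' r' n hl hr
    simp only [twists, Multiset.map_map, Function.comp_def, Node.relabel, hl, hr]
  have hrefl : ∀ D : Code, Multiset.Rel Node.Same D D := fun D =>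
    Multiset.rel_refl_of_refl_on fun v _ => Node.Same.refl v
  change Multiset.Rel Node.Same ((doubleTwistCode p q).map _) (doubleTwistCode q p)
  simp only [doubleTwistCode, Multiset.map_add, ht _ _ _ _ _ h0 h1, ht _ _ _ _ _ h2 h3,
    Multiset.insert_eq_cons, Multiset.map_cons, Multiset.map_singleton, Node.relabel, h0, h1, h2,
    h3]
  rw [add_comm (twists _ _ q) (twists _ _ p)]
  refine Multiset.Rel.add (hrefl _) (.cons (.swap _ _) ?_)
  rw [Multiset.cons_swap]
  exact .cons (.swap _ _) (.cons (.swap _ _) (.cons (.swap _ _) .zero))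

theorem eq_or_eq_swap_of_doubleTwistKnot_eq {p q a b : ℕ} {hp : Even p} {hq : Even q} {ha : Even a}
    {hb : Even b} (p_pos : 0 < p) (q_pos : 0 < q) (a_pos : 0 < a) (b_pos : 0 < b)
    (h : doubleTwistKnot p q hp hq = doubleTwistKnot a b ha hb) :
    p = a ∧ q = b ∨ p = b ∧ q = a := by
  obtain ⟨s, k, h⟩ := bracket_eq_of_knot_eq h
  -- The smaller root of u² - 3u + 1.
  obtain ⟨u, h0, h1, hu⟩ : ∃ u : ℝ, 0 < u ∧ u < 2 / 5 ∧ u + u⁻¹ = 3 := by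
    have h5 : √5 ^ 2 = (5 : ℝ) := Real.sq_sqrt (by norm_num)
    have hlt : √5 < (3 : ℝ) := by nlinarith [Real.sqrt_nonneg (5 : ℝ)]
    refine ⟨(3 - √5) / 2, by linarith, by nlinarith [Real.sqrt_nonneg (5 : ℝ)], ?_⟩
    rw [show ((3 - √5) / 2)⁻¹ = (3 + √5) / 2 from
      inv_eq_of_mul_eq_one_right (by nlinarith)]
    ring
  have hk : (s : ℤ) * u ^ k = (1 : ℝ) := by
    have e := h u h0.ne' hu
    obtain ⟨hl, hr⟩ := bracket_doubleTwistCode_bounds h0 h1 hu hp hq p_pos q_pos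
    obtain ⟨hl', hr'⟩ := bracket_doubleTwistCode_bounds h0 h1 hu ha hb a_pos b_pos
    change (doubleTwistCode p q).bracket u = _ * (doubleTwistCode a b).bracket u at e
    have hpos : 0 < u ^ k := zpow_pos h0 k
    rcases Int.units_eq_one_or s with rfl | rfl
    · simp only [Units.val_one, Int.cast_one, one_mul] at e ⊢
      refine zpow_eq_one_of_bounds h0 (by linarith) ?_ ?_
      · by_contra! hc
        nlinarith
      · by_contra! hc
        nlinarith
    · simp only [Units.val_neg, Units.val_one, Int.cast_neg, Int.cast_one] at e
      nlinarith
  -- The sign and the exponent do not depend on the root, so the unit is 1 at u⁻¹ as well.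
  have hs : (s : ℤ) * u⁻¹ ^ k = (1 : ℝ) := by
    rw [inv_zpow]
    rcases Int.units_eq_one_or s with rfl | rfl
    · simp at hk
      simp [hk]
    · simp at hk
      linarith [zpow_pos h0 k]
  have e := h u h0.ne' hu
  have e' := h u⁻¹ (inv_ne_zero h0.ne') (by rw [inv_inv, add_comm]; exact hu)
  rw [hk, one_mul] at e
  rw [hs, one_mul] at e'
  change (doubleTwistCode p q).bracket u = (doubleTwistCode a b).bracket u at e
  change (doubleTwistCode p q).bracket u⁻¹ = (doubleTwistCode a b).bracket u⁻¹ at e'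
  rw [bracket_doubleTwistCode_eq h0.ne' hu p_pos q_pos,
    bracket_doubleTwistCode_eq h0.ne' hu a_pos b_pos] at e
  have hu' : u⁻¹ + u⁻¹⁻¹ = 3 := by rw [inv_inv, add_comm]; exact hu
  rw [bracket_doubleTwistCode_eq (inv_ne_zero h0.ne') hu' p_pos q_pos,
    bracket_doubleTwistCode_eq (inv_ne_zero h0.ne') hu' a_pos b_pos] at e'
  rw [hp.neg_pow, hq.neg_pow, ha.neg_pow, hb.neg_pow] at e e'
  simp only [inv_pow] at e'
  have hinj : Function.Injective fun n : ℕ => (u ^ 2) ^ n :=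
    (pow_right_strictAnti₀ (by positivity) (by nlinarith)).injective
  rcases eq_or_eq_swap_of_eq (P := (u ^ 2) ^ p) (Q := (u ^ 2) ^ q) (A := (u ^ 2) ^ a)
    (B := (u ^ 2) ^ b) (by positivity) (by positivity) (by positivity) (by positivity)
    (by linarith) (by linarith) with ⟨h₁, h₂⟩ | ⟨h₁, h₂⟩
  · exact Or.inl ⟨hinj h₁, hinj h₂⟩
  · exact Or.inr ⟨hinj h₁, hinj h₂⟩

end KnotDiag

theorem theorem3p11 (p q a b : ℕ) (hp : Even p) (hq : Even q) (ha : Even a) (hb : Even b)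
    (p_pos : 0 < p) (q_pos : 0 < q) (a_pos : 0 < a) (b_pos : 0 < b) :
    KnotDiag.doubleTwistKnot p q hp hq = KnotDiag.doubleTwistKnot a b ha hb ↔
      ({p, q} : Set ℕ) = {a, b} := by
  rw [Set.pair_eq_pair_iff]
  refine ⟨KnotDiag.eq_or_eq_swap_of_doubleTwistKnot_eq p_pos q_pos a_pos b_pos, ?_⟩
  rintro (⟨rfl, rfl⟩ | ⟨rfl, rfl⟩)
  · rfl
  · exact KnotDiag.doubleTwistKnot_comm _ _ _ _
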